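/- For signed or unsigned positive integer arguments, let \[\zeta(s_1,\dots,s_m)=\lim_{n\to\infty}\sum_{n\ge k_1>\cdots>k_m\ge1}\frac{\varepsilon_1(k_1)\cdots\varepsilon_m(k_m)}{k_1^{s_1}\cdots k_m^{s_m}},\] where $\varepsilon_j(k)=(-1)^{k}$ if the $j$-th argument carries a bar (written $\bar s_j$) and $\varepsilon_j(k)=1$ otherwise; $\{1\}_{r}$ denotes $r$ consecutive arguments equal to $1$. For $|x|<1$ and integers $p,s_1,s_2\ge 1$ put \[\mathrm{Li}_p(x)=\sum_{n\ge1}\frac{x^n}{n^p},\qquad \zeta(s_1,s_2;x)=\sum_{k_1>k_2\ge1}\frac{x^{k_1}}{k_1^{s_1}k_2^{s_2}}.\] Then for every integer $k\ge1$ the limit defining $\zeta(\bar1,1,\bar1,\{1\}_{k-1})$ exists and \[\begin{aligned}\zeta(\bar1,1,\bar1,\{1\}_{k-1})={}&\ln2\;\mathrm{Li}_{k+1}\!\left(\tfrac12\right)-\frac{(-1)^k}{k!}\sum_{i=0}^{k}\sum_{l=0}^{i}(-1)^i\,l!\binom ki\binom il(\ln2)^{k+1-l}\,\mathrm{Li}_{l+1}\!\left(\tfrac12\right)\\&-\frac{(-1)^k}{k!}\sum_{i=0}^{k}\sum_{l=0}^{i}(-1)^{i-1}\,l!\binom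 ki\binom il(\ln2)^{k-l}\,\zeta\!\left(l+1,1;\tfrac12\right).\end{aligned}\] -/

import Mathlib

open Filter Topology

noncomputable section

/-- The factor contributed by one argument `s` of a multiple zeta value at the summation index `k`.
A positive entry `s` stands for the plain argument `s` and contributes `1 / k ^ s`; a negative
entry `-s` stands for the barred argument `s̄` and contributes `(-1) ^ k / k ^ s`. -/
def mzvFactor (s : ℤ) (k : ℕ) : ℝ :=
  (if s < 0 then (-1 : ℝ) ^ k else 1) / (k : ℝ) ^ s.natAbs

/-- The (alternating) multiple harmonic number
`ζ_n(s₁, …, s_m) = ∑_{n ≥ k₁ > ⋯ > k_m ≥ 1} ∏ j, mzvFactor s_j k_j`, written as an iterated sum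
with the outermost index first; `ζ_n(∅) = 1`. -/
def multiHarmonic : List ℤ → ℕ → ℝ
  | [], _ => 1
  | s :: t, n => ∑ k ∈ Finset.Icc 1 n, mzvFactor s k * multiHarmonic t (k - 1)

/-- The (alternating) multiple zeta value `ζ(s₁, …, s_m) = lim_{n → ∞} ζ_n(s₁, …, s_m)`. -/
def multiZeta (s : List ℤ) : ℝ :=
  limUnder atTop (multiHarmonic s)

/-- The polylogarithm `Li_p(x) = ∑_{n ≥ 1} x ^ n / n ^ p`, for `|x| < 1`. -/
def polyLog (p : ℕ) (x : ℝ) : ℝ :=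
  ∑' n : ℕ, x ^ (n + 1) / ((n + 1 : ℕ) : ℝ) ^ p

/-- The multiple polylogarithm
`ζ(s₁, …, s_m; x) = ∑_{k₁ > ⋯ > k_m ≥ 1} x ^ k₁ ∏ j, mzvFactor s_j k_j`, for `|x| < 1`;
the inner sum over `k₂ > ⋯ > k_m` is a multiple harmonic number (here `k₁ = n + 1`). -/
def multiPolyLog : List ℤ → ℝ → ℝ
  | [], _ => 1
  | s :: t, x => ∑' n : ℕ, x ^ (n + 1) * mzvFactor s (n + 1) * multiHarmonic t n

end

/-! The double sums collapse: `∑ i, (-1)^i C(k,i) C(i,l)` is `(-1)^k` for `l = k` and `0` otherwise,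
so the two `Li` terms cancel and the claim becomes `ζ(1̄,1,1̄,{1}_{k-1}) = ζ(k+1,1;1/2)`. Both sides
equal `∫₀¹ (ln 2 - ln(1+u)) q(u) du` with `q(u) = (-ln(1-u))^k / (k! (1+u))`. On the left, Abel's
theorem gives the value as the limit at `1⁻` of a multiple polylogarithm, which is an iterated
integral (`multiPolyLog_neg_one_one_neg_one`). On the right, substitute `u ↦ 1-u`, expand the kernel
as `∑ H_n u^n / 2^(n+1)` and integrate termwise (`multiPolyLog_succ_one_half`). -/

/-! ### Growth of multiple harmonic numbers. -/

theorem abs_mzvFactor_le {s : ℤ} (hs : s ≠ 0) {k : ℕ} (hk : 1 ≤ k) :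
    |mzvFactor s k| ≤ 1 / (k : ℝ) := by
  have hk' : (1 : ℝ) ≤ k := by exact_mod_cast hk
  have h1 : |(if s < 0 then (-1 : ℝ) ^ k else 1)| = 1 := by split_ifs <;> simp
  rw [mzvFactor, abs_div, h1, abs_pow, abs_of_pos (by linarith : (0 : ℝ) < k)]
  exact one_div_le_one_div_of_le (by linarith) (le_self_pow₀ hk' (Int.natAbs_ne_zero.mpr hs))

theorem multiHarmonic_cons_succ (s : ℤ) (t : List ℤ) (n : ℕ) :
    multiHarmonic (s :: t) (n + 1) =
      multiHarmonic (s :: t) n + mzvFactor s (n + 1) * multiHarmonic t n := by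
  simp only [multiHarmonic]
  rw [Finset.sum_Icc_succ_top (by omega)]
  simp

theorem multiHarmonic_cons_zero (s : ℤ) (t : List ℤ) : multiHarmonic (s :: t) 0 = 0 := by
  simp [multiHarmonic]

theorem multiHarmonic_cons_eq_sum_range (s : ℤ) (t : List ℤ) (n : ℕ) :
    multiHarmonic (s :: t) n =
      ∑ k ∈ Finset.range n, mzvFactor s (k + 1) * multiHarmonic t k := by
  induction n with
  | zero => simp [multiHarmonic_cons_zero]
  | succ n ih => rw [multiHarmonic_cons_succ, ih, Finset.sum_range_succ]

theorem harmonic_mono : Monotone (fun n : ℕ => (harmonic n : ℝ)) := by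
  refine monotone_nat_of_le_succ fun n => ?_
  rw [harmonic_succ]
  push_cast
  have : (0 : ℝ) ≤ ((n : ℝ) + 1)⁻¹ := by positivity
  linarith

theorem abs_multiHarmonic_le {t : List ℤ} (ht : ∀ s ∈ t, s ≠ 0) (n : ℕ) :
    |multiHarmonic t n| ≤ (harmonic n : ℝ) ^ t.length := by
  induction t generalizing n with
  | nil => simp [multiHarmonic]
  | cons s t ih =>
    have hn0 : (0 : ℝ) ≤ harmonic n := by simpa using harmonic_mono (Nat.zero_le n)
    rw [multiHarmonic_cons_eq_sum_range, List.length_cons, pow_succ']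
    refine (Finset.abs_sum_le_sum_abs _ _).trans ?_
    have : (harmonic n : ℝ) = ∑ k ∈ Finset.range n, 1 / ((k + 1 : ℕ) : ℝ) := by
      simp [harmonic]
    conv_rhs => rw [this]
    rw [Finset.sum_mul, ← this]
    refine Finset.sum_le_sum fun k hk => ?_
    rw [abs_mul]
    refine mul_le_mul (abs_mzvFactor_le (ht s (by simp)) (by omega)) ?_ (abs_nonneg _)
      (by positivity)
    refine (ih (fun s hs => ht s (by simp [hs])) k).trans ?_
    refine pow_le_pow_left₀ (by simpa using harmonic_mono (Nat.zero_le k)) ?_ _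
    exact harmonic_mono (Finset.mem_range.mp hk).le

/-- Powers of `log n` are absorbed into `n^(1/2)`; after division by `n²` this leaves the summable
`n^(-3/2)` used for convergence. -/
theorem exists_abs_multiHarmonic_le_rpow {t : List ℤ} (ht : ∀ s ∈ t, s ≠ 0) :
    ∃ C : ℝ, 0 ≤ C ∧ ∀ n : ℕ, |multiHarmonic t n| ≤ C * ((n : ℝ) + 1) ^ (1 / 2 : ℝ) := by
  set d := t.length with hd
  -- Chosen so that `d * δ ≤ 1/2`.
  set δ : ℝ := 1 / (2 * (d + 1)) with hδ
  have hδ0 : 0 < δ := by positivity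
  refine ⟨(1 + 1 / δ) ^ d, by positivity, fun n => ?_⟩
  have hn : (1 : ℝ) ≤ (n : ℝ) + 1 := by linarith [Nat.cast_nonneg (α := ℝ) n]
  have hH : (harmonic n : ℝ) ≤ (1 + 1 / δ) * ((n : ℝ) + 1) ^ δ := by
    have h1 := (harmonic_mono n.le_succ).trans (harmonic_le_one_add_log (n + 1))
    have h2 := Real.log_le_rpow_div (by linarith : (0 : ℝ) ≤ (n : ℝ) + 1) hδ0
    have h3 := Real.one_le_rpow hn hδ0.le
    push_cast at h1
    rw [add_mul, one_mul, one_div, inv_mul_eq_div]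
    linarith
  refine (abs_multiHarmonic_le ht n).trans ?_
  refine (pow_le_pow_left₀ (by simpa using harmonic_mono (Nat.zero_le n)) hH _).trans ?_
  rw [mul_pow, ← Real.rpow_natCast (_ ^ δ), ← Real.rpow_mul (by linarith)]
  refine mul_le_mul_of_nonneg_left (Real.rpow_le_rpow_of_exponent_le hn ?_) (by positivity)
  rw [hδ, div_mul_eq_mul_div, one_mul, div_le_div_iff₀ (by positivity) (by norm_num)]
  linarith

theorem abs_multiHarmonic_le_mul {t : List ℤ} (ht : ∀ s ∈ t, s ≠ 0) :
    ∃ C : ℝ, 0 ≤ C ∧ ∀ n : ℕ, |multiHarmonic t n| ≤ C * ((n : ℝ) + 1) := by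
  obtain ⟨C, hC, h⟩ := exists_abs_multiHarmonic_le_rpow ht
  refine ⟨C, hC, fun n => (h n).trans (mul_le_mul_of_nonneg_left ?_ hC)⟩
  have hn : (1 : ℝ) ≤ (n : ℝ) + 1 := by linarith [Nat.cast_nonneg (α := ℝ) n]
  simpa using Real.rpow_le_rpow_of_exponent_le hn (by norm_num : (1 / 2 : ℝ) ≤ 1)

/-! ### Generating functions and derivatives of multiple polylogarithms. -/

theorem summable_succ_mul_pow {r : ℝ} (h0 : 0 ≤ r) (hr : r < 1) :
    Summable (fun n : ℕ => ((n : ℝ) + 1) * r ^ n) := by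
  have h1 := summable_pow_mul_geometric_of_norm_lt_one 1 (r := r) (by
    rwa [Real.norm_of_nonneg h0])
  have h2 := summable_geometric_of_lt_one h0 hr
  refine (h1.add h2).congr fun n => ?_
  ring

theorem abs_pow_mul_multiHarmonic_le {t : List ℤ} {C : ℝ}
    (h : ∀ n : ℕ, |multiHarmonic t n| ≤ C * ((n : ℝ) + 1)) {x r : ℝ} (hx : |x| ≤ r) (n : ℕ) :
    |x ^ n * multiHarmonic t n| ≤ C * (((n : ℝ) + 1) * r ^ n) := by
  rw [abs_mul, abs_pow]
  calc |x| ^ n * |multiHarmonic t n| ≤ r ^ n * (C * ((n : ℝ) + 1)) :=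
        mul_le_mul (pow_le_pow_left₀ (abs_nonneg _) hx _) (h n) (abs_nonneg _)
          (pow_nonneg ((abs_nonneg _).trans hx) _)
    _ = _ := by ring

theorem summable_pow_mul_multiHarmonic {t : List ℤ} (ht : ∀ s ∈ t, s ≠ 0) {x : ℝ} (hx : |x| < 1) :
    Summable (fun n : ℕ => x ^ n * multiHarmonic t n) := by
  obtain ⟨C, -, h⟩ := abs_multiHarmonic_le_mul ht
  exact ((summable_succ_mul_pow (abs_nonneg x) hx).mul_left C).of_norm_bounded
    fun n => abs_pow_mul_multiHarmonic_le h le_rfl n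

theorem summable_multiPolyLog {s : ℤ} {t : List ℤ} (hs : s ≠ 0) (ht : ∀ s ∈ t, s ≠ 0) {x : ℝ}
    (hx : |x| < 1) :
    Summable (fun n : ℕ => x ^ (n + 1) * mzvFactor s (n + 1) * multiHarmonic t n) := by
  refine ((summable_pow_mul_multiHarmonic ht hx).norm).of_norm_bounded fun n => ?_
  have h1 := abs_mzvFactor_le hs (Nat.le_add_left 1 n)
  have h2 : (1 : ℝ) / ((n + 1 : ℕ) : ℝ) ≤ 1 := by
    rw [div_le_one (by positivity)]; push_cast; linarith [Nat.cast_nonneg (α := ℝ) n]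
  simp only [Real.norm_eq_abs, abs_mul, pow_succ]
  refine mul_le_mul_of_nonneg_right ?_ (abs_nonneg _)
  have h3 : |x| * |mzvFactor s (n + 1)| ≤ 1 * 1 :=
    mul_le_mul hx.le (h1.trans h2) (abs_nonneg _) zero_le_one
  nlinarith [abs_nonneg (x ^ n)]

/-- The generating function of `ζ_n(t)` is `ζ(t; x) / (1 - x)`. -/
theorem tsum_pow_mul_multiHarmonic {t : List ℤ} (ht : ∀ s ∈ t, s ≠ 0) {x : ℝ} (hx : |x| < 1) :
    ∑' n : ℕ, x ^ n * multiHarmonic t n = multiPolyLog t x / (1 - x) := by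
  have hx1 : 1 - x ≠ 0 := by linarith [(abs_lt.mp hx).2]
  cases t with
  | nil => simp [multiHarmonic, multiPolyLog, tsum_geometric_of_abs_lt_one hx]
  | cons s t =>
    have hS := summable_pow_mul_multiHarmonic ht hx
    have hP := summable_multiPolyLog (t := t) (ht s (by simp))
      (fun r hr => ht r (List.mem_cons_of_mem _ hr)) hx
    rw [eq_div_iff hx1]
    have h1 := hS.tsum_eq_zero_add
    have h2 : ∑' n : ℕ, x ^ (n + 1) * multiHarmonic (s :: t) (n + 1) =
        x * (∑' n : ℕ, x ^ n * multiHarmonic (s :: t) n) + multiPolyLog (s :: t) x := by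
      rw [multiPolyLog, ← tsum_mul_left, ← (hS.mul_left x).tsum_add hP]
      refine tsum_congr fun n => ?_
      rw [multiHarmonic_cons_succ]
      ring
    rw [multiHarmonic_cons_zero, h2] at h1
    linarith

theorem mzvFactor_one (k : ℕ) : mzvFactor 1 k = 1 / (k : ℝ) := by simp [mzvFactor]

theorem mzvFactor_neg_one (k : ℕ) : mzvFactor (-1) k = (-1) ^ k / (k : ℝ) := by simp [mzvFactor]

theorem multiPolyLog_neg_one_cons (t : List ℤ) (x : ℝ) :
    multiPolyLog (-1 :: t) x = multiPolyLog (1 :: t) (-x) := by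
  simp only [multiPolyLog, mzvFactor_one, mzvFactor_neg_one]
  refine tsum_congr fun n => ?_
  rw [neg_pow x]
  ring

theorem multiPolyLog_cons_zero (s : ℤ) (t : List ℤ) : multiPolyLog (s :: t) 0 = 0 := by
  simp [multiPolyLog]

/-- Differentiating termwise cancels the outer `1/k₁` and leaves the generating function of
`ζ_n(t)`. -/
theorem hasDerivAt_multiPolyLog_one_cons {t : List ℤ} (ht : ∀ s ∈ t, s ≠ 0) {x : ℝ}
    (hx : |x| < 1) :
    HasDerivAt (multiPolyLog (1 :: t)) (multiPolyLog t x / (1 - x)) x := by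
  obtain ⟨C, -, h⟩ := abs_multiHarmonic_le_mul ht
  obtain ⟨r, hxr, hr⟩ := exists_between hx
  rw [← tsum_pow_mul_multiHarmonic ht hx]
  have hball : ∀ y ∈ Metric.ball (0 : ℝ) r, |y| < r := fun y hy => by simpa using hy
  refine hasDerivAt_tsum_of_isPreconnected
    (g := fun (n : ℕ) (y : ℝ) => y ^ (n + 1) * mzvFactor 1 (n + 1) * multiHarmonic t n)
    (g' := fun (n : ℕ) (y : ℝ) => y ^ n * multiHarmonic t n)
    (t := Metric.ball 0 r) (y₀ := x)
    ((summable_succ_mul_pow ((abs_nonneg x).trans hxr.le) hr).mul_left C)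
    Metric.isOpen_ball (convex_ball _ _).isPreconnected ?_ ?_ (by simpa using hxr)
    (summable_multiPolyLog one_ne_zero ht hx) (by simpa using hxr)
  · intro n y _
    have := (((hasDerivAt_pow (n + 1) y).mul_const (mzvFactor 1 (n + 1))).mul_const
      (multiHarmonic t n))
    convert! this using 1
    rw [mzvFactor_one]
    have : (((n + 1 : ℕ)) : ℝ) ≠ 0 := by positivity
    field_simp
    simp [mul_comm]
  · intro n y hy
    exact abs_pow_mul_multiHarmonic_le h (hball y hy).le n

/-- By induction both sides have the same derivative on the unit ball, and both vanish at `0` when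
`k > 0`. -/
theorem multiPolyLog_replicate_one (k : ℕ) {x : ℝ} (hx : |x| < 1) :
    multiPolyLog (List.replicate k 1) x = (-Real.log (1 - x)) ^ k / (k.factorial : ℝ) := by
  induction k generalizing x with
  | zero => simp [multiPolyLog]
  | succ k ih =>
    have hd : ∀ y ∈ Metric.ball (0 : ℝ) 1, HasDerivAt (fun y => multiPolyLog
        (List.replicate (k + 1) 1) y - (-Real.log (1 - y)) ^ (k + 1) / ((k + 1).factorial : ℝ))
        0 y := by
      intro y hy
      have hy : |y| < 1 := by simpa using hy
      have hy1 : 1 - y ≠ 0 := by linarith [(abs_lt.mp hy).2]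
      have h1 := hasDerivAt_multiPolyLog_one_cons (t := List.replicate k 1)
        (fun s hs => by simp [List.eq_of_mem_replicate hs]) hy
      have h2 := ((((((hasDerivAt_id y).const_sub 1).log hy1).neg).pow (k + 1)).div_const
        ((k + 1).factorial : ℝ))
      rw [ih hy] at h1
      convert! h1.sub h2 using 1
      rw [Nat.factorial_succ]
      have : (k.factorial : ℝ) ≠ 0 := by positivity
      have : ((k : ℝ) + 1) ≠ 0 := by positivity
      push_cast
      simp only [id, Pi.neg_apply]
      field_simp
      ring
    have h0 := (convex_ball (0 : ℝ) 1).is_const_of_fderivWithin_eq_zero (𝕜 := ℝ) (E := ℝ)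
      (fun y hy => (hd y hy).differentiableAt.differentiableWithinAt)
      (fun y hy => by
        rw [fderivWithin_of_isOpen Metric.isOpen_ball hy]
        simpa using (hd y hy).hasFDerivAt.fderiv)
      (show x ∈ Metric.ball (0 : ℝ) 1 by simpa using hx) (Metric.mem_ball_self one_pos)
    simp only [List.replicate_succ, multiPolyLog_cons_zero] at h0 ⊢
    simp at h0
    linarith

/-! ### Convergence and Abel summation. -/

/-- Summation by parts against the outer sign `(-1)^k`: `a n → 0` and its differences are
`O(n^(-3/2))`. -/
theorem tendsto_multiHarmonic_neg_one_cons {s : ℤ} {t : List ℤ} (hs : s ≠ 0)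
    (ht : ∀ s ∈ t, s ≠ 0) :
    ∃ l : ℝ, Tendsto (multiHarmonic (-1 :: s :: t)) atTop (𝓝 l) := by
  obtain ⟨C, hC, hb⟩ := exists_abs_multiHarmonic_le_rpow (t := s :: t)
    (by simpa [hs] using ht)
  obtain ⟨D, hD, hd⟩ := exists_abs_multiHarmonic_le_rpow ht
  -- Shifted index: the outer summand at `n + 1` is `(-1)^(n+1) * a n`.
  set a : ℕ → ℝ := fun n => multiHarmonic (s :: t) n / ((n : ℝ) + 1) with ha
  have hpos : ∀ n : ℕ, (0 : ℝ) < (n : ℝ) + 1 := fun n => by positivity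
  have hrp : ∀ n : ℕ, ((n : ℝ) + 1) ^ (1 / 2 : ℝ) / ((n : ℝ) + 1) = ((n : ℝ) + 1) ^ (-(1 / 2) : ℝ) :=
    fun n => by
      rw [← Real.rpow_sub_one (hpos n).ne']; norm_num
  have hrp2 : ∀ n : ℕ, ((n : ℝ) + 1) ^ (1 / 2 : ℝ) / ((n : ℝ) + 1) ^ 2 =
      ((n + 1 : ℕ) : ℝ) ^ (-(3 / 2) : ℝ) := fun n => by
    rw [← Real.rpow_natCast, ← Real.rpow_sub (hpos n)]; norm_num
  have ha0 : Tendsto a atTop (𝓝 0) := by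
    have h1 : Tendsto (fun n : ℕ => C * ((n : ℝ) + 1) ^ (-(1 / 2) : ℝ)) atTop (𝓝 (C * 0)) :=
      (((tendsto_rpow_neg_atTop (by norm_num : (0 : ℝ) < 1 / 2)).comp
        (tendsto_atTop_add_const_right _ 1 tendsto_natCast_atTop_atTop))).const_mul C
    rw [mul_zero] at h1
    refine squeeze_zero_norm (fun n => ?_) h1
    rw [ha, Real.norm_eq_abs, abs_div, abs_of_pos (hpos n), ← hrp, ← mul_div_assoc]
    exact div_le_div_of_nonneg_right (hb n) (hpos n).le
  have hdiff : Summable (fun n : ℕ => (-1 : ℝ) ^ (n + 1) * (a n - a (n + 1))) := by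
    have h1 : Summable (fun n : ℕ => (C + D) * ((n + 1 : ℕ) : ℝ) ^ (-(3 / 2) : ℝ)) :=
      ((summable_nat_add_iff 1).mpr
        (Real.summable_nat_rpow.mpr (by norm_num : (-(3 / 2) : ℝ) < -1))).mul_left _
    refine h1.of_norm_bounded fun n => ?_
    have hp := hpos n
    have hf := abs_mzvFactor_le hs (Nat.le_add_left 1 n)
    have e : a n - a (n + 1) = multiHarmonic (s :: t) n / (((n : ℝ) + 1) * ((n : ℝ) + 2)) -
        mzvFactor s (n + 1) * multiHarmonic t n / ((n : ℝ) + 2) := by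
      simp only [ha, multiHarmonic_cons_succ]
      push_cast
      field_simp
      ring
    rw [norm_mul, norm_pow, norm_neg, norm_one, one_pow, one_mul, e, ← hrp2, add_mul C D]
    refine (norm_sub_le _ _).trans (add_le_add ?_ ?_)
    · rw [Real.norm_eq_abs, abs_div, abs_of_pos (by positivity : 0 < ((n : ℝ) + 1) * ((n : ℝ) + 2)),
        ← mul_div_assoc]
      exact div_le_div₀ (by positivity) (hb n) (by positivity) (by nlinarith)
    · rw [Real.norm_eq_abs, abs_div, abs_of_pos (by positivity : 0 < (n : ℝ) + 2), abs_mul,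
        ← mul_div_assoc]
      have h2 : |mzvFactor s (n + 1)| * |multiHarmonic t n| ≤
          1 / ((n : ℝ) + 1) * (D * ((n : ℝ) + 1) ^ (1 / 2 : ℝ)) :=
        mul_le_mul (by simpa using hf) (hd n) (abs_nonneg _) (by positivity)
      calc _ ≤ 1 / ((n : ℝ) + 1) * (D * ((n : ℝ) + 1) ^ (1 / 2 : ℝ)) / ((n : ℝ) + 1) :=
            div_le_div₀ (by positivity) h2 (by positivity) (by linarith)
        _ = _ := by field_simp
  have hsum : ∀ n : ℕ, multiHarmonic (-1 :: s :: t) n =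
      ((∑ k ∈ Finset.range n, (-1 : ℝ) ^ (k + 1) * (a k - a (k + 1))) + (-1) ^ n * a n - a 0) / 2 := by
    intro n
    induction n with
    | zero => simp [multiHarmonic_cons_zero]
    | succ n ih =>
      rw [multiHarmonic_cons_succ, ih, Finset.sum_range_succ, mzvFactor_neg_one]
      have : (-1 : ℝ) ^ (n + 1) / ((n + 1 : ℕ) : ℝ) * multiHarmonic (s :: t) n =
        (-1 : ℝ) ^ (n + 1) * a n := by simp only [ha]; push_cast; ring
      rw [this]
      ring
  refine ⟨((∑' k : ℕ, (-1 : ℝ) ^ (k + 1) * (a k - a (k + 1))) + 0 - a 0) / 2, ?_⟩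
  refine Tendsto.congr (fun n => (hsum n).symm) ?_
  refine ((hdiff.hasSum.tendsto_sum_nat.add ?_).sub_const _).div_const 2
  refine squeeze_zero_norm (fun n => ?_) (tendsto_zero_iff_norm_tendsto_zero.mp ha0)
  simp

theorem tendsto_multiPolyLog_of_tendsto_multiHarmonic {s : ℤ} {t : List ℤ} {l : ℝ}
    (h : Tendsto (multiHarmonic (s :: t)) atTop (𝓝 l)) :
    Tendsto (multiPolyLog (s :: t)) (𝓝[<] 1) (𝓝 l) := by
  have h1 := Real.tendsto_tsum_powerSeries_nhdsWithin_lt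
    (f := fun n => mzvFactor s (n + 1) * multiHarmonic t n)
    (h.congr fun n => multiHarmonic_cons_eq_sum_range s t n)
  -- The polylogarithm is `x` times the power series in Abel's theorem, whose exponents start at
  -- `0`.
  have h2 : Tendsto (fun x : ℝ => x) (𝓝[<] 1) (𝓝 1) := tendsto_nhdsWithin_of_tendsto_nhds tendsto_id
  have h3 := h2.mul h1
  rw [one_mul] at h3
  refine h3.congr fun x => ?_
  rw [multiPolyLog, ← tsum_mul_left]
  refine tsum_congr fun n => ?_
  ring

/-! ### Moments of powers of the logarithm. -/

theorem intervalIntegrable_neg_log_pow (k : ℕ) :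
    IntervalIntegrable (fun u : ℝ => (-Real.log u) ^ k) MeasureTheory.volume 0 1 := by
  -- Then `k * δ < 1`, so the majorant `u^(-kδ)` is integrable at `0`.
  set δ : ℝ := 1 / (k + 1) with hδ
  have hδ0 : 0 < δ := by positivity
  have hr : (-1 : ℝ) < -(k * δ) := by
    rw [neg_lt_neg_iff, hδ, mul_one_div, div_lt_one (by positivity)]
    linarith
  refine ((intervalIntegral.intervalIntegrable_rpow' hr).const_mul ((1 / δ) ^ k)).mono_fun'
    (Real.measurable_log.neg.pow_const k).aestronglyMeasurable ?_
  refine (MeasureTheory.ae_restrict_iff' measurableSet_uIoc).mpr (Eventually.of_forall fun u hu => ?_)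
  rw [Set.uIoc_of_le zero_le_one] at hu
  have h1 := (Real.abs_log_mul_self_rpow_lt u δ hu.1 hu.2 hδ0).le
  have h2 : 0 < u ^ δ := Real.rpow_pos_of_pos hu.1 _
  rw [abs_mul, abs_of_pos h2] at h1
  have h3 := pow_le_pow_left₀ (by positivity) h1 k
  rw [mul_pow, ← Real.rpow_natCast (u ^ δ), ← Real.rpow_mul hu.1.le, mul_comm δ] at h3
  beta_reduce
  rw [norm_pow, norm_neg, Real.norm_eq_abs, Real.rpow_neg hu.1.le, ← div_eq_mul_inv,
    le_div_iff₀ (Real.rpow_pos_of_pos hu.1 _)]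
  exact h3

theorem intervalIntegrable_pow_mul_neg_log_pow (n k : ℕ) :
    IntervalIntegrable (fun u : ℝ => u ^ n * (-Real.log u) ^ k) MeasureTheory.volume 0 1 :=
  (intervalIntegrable_neg_log_pow k).continuousOn_mul (by fun_prop)

theorem tendsto_pow_mul_neg_log_pow (n k : ℕ) :
    Tendsto (fun u : ℝ => u ^ (n + 1) * (-Real.log u) ^ (k + 1)) (𝓝[>] 0) (𝓝 0) := by
  have h1 := tendsto_log_mul_rpow_nhdsGT_zero (r := 1 / ((k + 1 : ℕ) : ℝ)) (by positivity)
  have h2 : Tendsto (fun u : ℝ => u) (𝓝[>] 0) (𝓝 0) :=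
    tendsto_nhdsWithin_of_tendsto_nhds tendsto_id
  have h3 := (h2.pow n).mul (h1.neg.pow (k + 1))
  rw [neg_zero, zero_pow (Nat.succ_ne_zero k), mul_zero] at h3
  refine h3.congr' (eventually_mem_nhdsWithin.mono fun u hu => ?_)
  have hu : 0 < u := hu
  rw [← neg_mul, mul_pow, ← Real.rpow_natCast (u ^ (1 / ((k + 1 : ℕ) : ℝ))), ← Real.rpow_mul hu.le,
    one_div, inv_mul_cancel₀ (by positivity), Real.rpow_one]
  ring

theorem integral_pow_mul_neg_log_pow (n k : ℕ) :
    ∫ u in (0 : ℝ)..1, u ^ n * (-Real.log u) ^ k = (k.factorial : ℝ) / ((n : ℝ) + 1) ^ (k + 1) := by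
  induction k with
  | zero => simp
  | succ k ih =>
    have hn : (n : ℝ) + 1 ≠ 0 := by positivity
    have hi1 := (intervalIntegrable_pow_mul_neg_log_pow n (k + 1)).const_mul ((n : ℝ) + 1)
    have hi2 := (intervalIntegrable_pow_mul_neg_log_pow n k).const_mul ((k : ℝ) + 1)
    have h := intervalIntegral.integral_eq_sub_of_hasDerivAt_of_tendsto zero_lt_one
      (f := fun u : ℝ => u ^ (n + 1) * (-Real.log u) ^ (k + 1)) (fb := 0)
      (fun u hu => by
        have hu0 : u ≠ 0 := hu.1.ne'
        convert! (hasDerivAt_pow (n + 1) u).mul ((Real.hasDerivAt_log hu0).neg.pow (k + 1)) using 1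
        simp only [Nat.add_sub_cancel, Pi.neg_apply, Pi.pow_apply, pow_succ u n]
        push_cast
        field_simp
        ring)
      (hi1.sub hi2) (tendsto_pow_mul_neg_log_pow n k)
      (by
        have : ContinuousAt (fun u : ℝ => u ^ (n + 1) * (-Real.log u) ^ (k + 1)) 1 := by
          have := Real.continuousAt_log one_ne_zero
          fun_prop
        simpa using tendsto_nhdsWithin_of_tendsto_nhds (s := Set.Iio 1) this.tendsto)
    rw [intervalIntegral.integral_sub hi1 hi2, intervalIntegral.integral_const_mul,
      intervalIntegral.integral_const_mul, ih] at h
    rw [Nat.factorial_succ, pow_succ, eq_div_iff (by positivity)]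
    push_cast
    field_simp at h
    linear_combination h

/-! ### The two integral representations. -/

theorem intervalIntegrable_neg_log_one_sub_pow_div (k : ℕ) :
    IntervalIntegrable (fun u : ℝ => (-Real.log (1 - u)) ^ k / (k.factorial : ℝ) / (1 + u))
      MeasureTheory.volume 0 1 := by
  have h := ((intervalIntegrable_neg_log_pow k).comp_sub_left 1).symm
  norm_num at h
  simp only [div_eq_mul_inv]
  refine (h.mul_const _).mul_continuousOn ?_
  refine ContinuousOn.inv₀ (by fun_prop) fun u hu => ?_
  rw [Set.uIcc_of_le zero_le_one] at hu
  linarith [hu.1]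

theorem continuousOn_log_one_add : ContinuousOn (fun u : ℝ => Real.log (1 + u)) (Set.uIcc 0 1) :=
  ContinuousOn.log (by fun_prop) fun u hu => by
    rw [Set.uIcc_of_le zero_le_one] at hu
    linarith [hu.1]

theorem multiPolyLog_neg_one_one_neg_one {k : ℕ} (hk : 1 ≤ k) {x : ℝ} (hx0 : 0 ≤ x) (hx1 : x < 1) :
    multiPolyLog (-1 :: 1 :: -1 :: List.replicate (k - 1) 1) x =
      Real.log (1 + x) * (∫ u in (0 : ℝ)..x, (-Real.log (1 - u)) ^ k / (k.factorial : ℝ) / (1 + u)) -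
      ∫ u in (0 : ℝ)..x,
        Real.log (1 + u) * ((-Real.log (1 - u)) ^ k / (k.factorial : ℝ) / (1 + u)) := by
  set q : ℝ → ℝ := fun u => (-Real.log (1 - u)) ^ k / (k.factorial : ℝ) / (1 + u) with hq
  set t : List ℤ := -1 :: List.replicate (k - 1) 1 with ht
  have ht0 : ∀ s ∈ t, s ≠ 0 := fun s hs => by
    rcases List.mem_cons.mp hs with rfl | hs
    · norm_num
    · simp [List.eq_of_mem_replicate hs]
  have hq' : ∀ y, |y| < 1 → multiPolyLog t (-y) / (1 + y) = q y := fun y hy => by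
    have e : (1 : ℤ) :: List.replicate (k - 1) 1 = List.replicate k 1 := by
      rw [← List.replicate_succ, Nat.sub_add_cancel hk]
    rw [ht, multiPolyLog_neg_one_cons, neg_neg, e, multiPolyLog_replicate_one k hy]
  -- This primitive of `q` and the function in `hΦ` carry out integration by parts: the derivative
  -- of `log (1 + y) * W - Φ` is `log (1 + y) * q`.
  have hW : ∀ y, |y| < 1 → HasDerivAt (fun y => -multiPolyLog (1 :: t) (-y)) (q y) y := fun y hy => by
    have h := ((hasDerivAt_multiPolyLog_one_cons ht0 (x := -y) (by simpa using hy)).comp y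
      (hasDerivAt_neg y)).neg
    rw [← hq' y hy]
    convert! h using 1
    rw [sub_neg_eq_add]; ring
  have hΦ : ∀ y, |y| < 1 → HasDerivAt (fun y => multiPolyLog (1 :: 1 :: t) (-y))
      (-multiPolyLog (1 :: t) (-y) / (1 + y)) y := fun y hy => by
    have h := ((hasDerivAt_multiPolyLog_one_cons (t := 1 :: t)
      (by simpa using ht0) (x := -y) (by simpa using hy)).comp y (hasDerivAt_neg y))
    convert! h using 1
    rw [sub_neg_eq_add]; ring
  have hsub : ∀ y ∈ Set.uIcc 0 x, |y| < 1 := fun y hy => by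
    rw [Set.uIcc_of_le hx0] at hy
    exact abs_lt.mpr ⟨by linarith [hy.1], by linarith [hy.2]⟩
  have hmono : Set.uIcc 0 x ⊆ Set.uIcc (0 : ℝ) 1 := by
    rw [Set.uIcc_of_le hx0, Set.uIcc_of_le zero_le_one]
    exact Set.Icc_subset_Icc_right hx1.le
  have hi := intervalIntegrable_neg_log_one_sub_pow_div k
  have h1 := intervalIntegral.integral_eq_sub_of_hasDerivAt (fun y hy => hW y (hsub y hy))
    (hi.mono_set hmono)
  have h2 := intervalIntegral.integral_eq_sub_of_hasDerivAt
    (f := fun y => Real.log (1 + y) * -multiPolyLog (1 :: t) (-y) - multiPolyLog (1 :: 1 :: t) (-y))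
    (f' := fun y => Real.log (1 + y) * q y)
    (fun y hy => by
      have hy := hsub y hy
      have hy1 : 1 + y ≠ 0 := by linarith [(abs_lt.mp hy).1]
      have h := ((((hasDerivAt_id y).const_add 1).log hy1).mul (hW y hy)).sub (hΦ y hy)
      convert! h using 1
      simp only [id]
      ring)
    ((hi.continuousOn_mul continuousOn_log_one_add).mono_set hmono)
  rw [h1, h2, multiPolyLog_neg_one_cons]
  simp [multiPolyLog_cons_zero]

theorem multiPolyLog_succ_one_half (k : ℕ) :
    multiPolyLog [(k : ℤ) + 1, 1] (1 / 2) =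
      Real.log 2 * (∫ u in (0 : ℝ)..1, (-Real.log (1 - u)) ^ k / (k.factorial : ℝ) / (1 + u)) -
      ∫ u in (0 : ℝ)..1,
        Real.log (1 + u) * ((-Real.log (1 - u)) ^ k / (k.factorial : ℝ) / (1 + u)) := by
  have hi := intervalIntegrable_neg_log_one_sub_pow_div k
  rw [← intervalIntegral.integral_const_mul, ← intervalIntegral.integral_sub (hi.const_mul _)
    (hi.continuousOn_mul continuousOn_log_one_add)]
  have hsub := intervalIntegral.integral_comp_sub_left (a := 0) (b := 1)
    (fun u : ℝ => (Real.log 2 - Real.log (2 - u)) / (2 - u) *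
      ((-Real.log u) ^ k / (k.factorial : ℝ))) 1
  have hk0 : (k.factorial : ℝ) ≠ 0 := by positivity
  have hH : ∀ n, 0 ≤ multiHarmonic [1] n := fun n => by
    simp only [multiHarmonic, mzvFactor_one]
    exact Finset.sum_nonneg fun i _ => by positivity
  -- Terms of the expansion of `-log (1 - u/2) / (2 - u)`, weighted by `(-log u)^k / k!`. They are
  -- nonnegative on `(0,1]`, so summability of their integrals justifies the interchange.
  set F : ℕ → ℝ → ℝ := fun n u => multiHarmonic [1] n / 2 ^ (n + 1) / (k.factorial : ℝ) *
    (u ^ n * (-Real.log u) ^ k) with hF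
  have hFint : ∀ n, ∫ u in Set.Ioc (0 : ℝ) 1, F n u =
      (1 / 2) ^ (n + 1) * mzvFactor ((k : ℤ) + 1) (n + 1) * multiHarmonic [1] n := fun n => by
    rw [← intervalIntegral.integral_of_le zero_le_one, hF]
    simp only [intervalIntegral.integral_const_mul, integral_pow_mul_neg_log_pow]
    have e1 : ¬ ((k : ℤ) + 1 < 0) := by omega
    have e2 : ((k : ℤ) + 1).natAbs = k + 1 := by omega
    simp only [mzvFactor, e1, e2, if_false]
    have : ((n : ℝ) + 1) ≠ 0 := by positivity
    push_cast
    rw [one_div_pow]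
    field_simp
  have hFi : ∀ n, MeasureTheory.Integrable (F n) (MeasureTheory.volume.restrict (Set.Ioc 0 1)) :=
    fun n => (intervalIntegrable_iff_integrableOn_Ioc_of_le zero_le_one).mp
      ((intervalIntegrable_pow_mul_neg_log_pow n k).const_mul _)
  have hFnorm : ∀ n, ∫ u in Set.Ioc (0 : ℝ) 1, ‖F n u‖ = ∫ u in Set.Ioc (0 : ℝ) 1, F n u := fun n =>
    MeasureTheory.setIntegral_congr_fun measurableSet_Ioc fun u hu => by
      refine Real.norm_of_nonneg ?_
      have h1 : 0 ≤ -Real.log u := neg_nonneg.mpr (Real.log_nonpos hu.1.le hu.2)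
      have h2 := hH n
      have h3 := hu.1.le
      simp only [hF]
      positivity
  have hsum := MeasureTheory.hasSum_integral_of_summable_integral_norm hFi (by
    simp only [hFnorm, hFint]
    exact summable_multiPolyLog (by omega) (by simp) (by norm_num [abs_of_pos]))
  simp only [hFint] at hsum
  have hval : ∫ u in Set.Ioc (0 : ℝ) 1, ∑' n, F n u = ∫ u in (0 : ℝ)..1,
      (Real.log 2 - Real.log (2 - u)) / (2 - u) * ((-Real.log u) ^ k / (k.factorial : ℝ)) := by
    rw [intervalIntegral.integral_of_le zero_le_one]
    refine MeasureTheory.setIntegral_congr_fun measurableSet_Ioc fun u hu => ?_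
    have hu2 : |u / 2| < 1 := by
      rw [abs_of_pos (by linarith [hu.1])]
      linarith [hu.2]
    have hpos : 0 < 2 - u := by linarith [hu.2]
    have hg := tsum_pow_mul_multiHarmonic (t := [1]) (by simp) hu2
    have hl := multiPolyLog_replicate_one 1 hu2
    rw [show (List.replicate 1 1 : List ℤ) = [1] from rfl] at hl
    rw [hl, show 1 - u / 2 = (2 - u) / 2 by ring, Real.log_div hpos.ne' two_ne_zero] at hg
    have e : ∀ n, F n u = (u / 2) ^ n * multiHarmonic [1] n *
        ((-Real.log u) ^ k / (k.factorial : ℝ) / 2) := fun n => by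
      simp only [hF, div_pow, pow_succ]
      field_simp
    simp only [e, tsum_mul_right, hg]
    simp
    field_simp
  rw [multiPolyLog, hsum.tsum_eq, hval]
  norm_num at hsub
  rw [← hsub]
  refine intervalIntegral.integral_congr fun u _ => ?_
  simp only [show 2 - (1 - u) = 1 + u by ring]
  ring

theorem tendsto_multiHarmonic_neg_one_one_neg_one {k : ℕ} (hk : 1 ≤ k) :
    Tendsto (multiHarmonic (-1 :: 1 :: -1 :: List.replicate (k - 1) 1)) atTop
      (𝓝 (multiPolyLog [(k : ℤ) + 1, 1] (1 / 2))) := by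
  have ht0 : ∀ s ∈ (-1 :: List.replicate (k - 1) 1 : List ℤ), s ≠ 0 := fun s hs => by
    rcases List.mem_cons.mp hs with rfl | hs
    · norm_num
    · simp [List.eq_of_mem_replicate hs]
  obtain ⟨l, hl⟩ := tendsto_multiHarmonic_neg_one_cons one_ne_zero ht0
  have h1 := tendsto_multiPolyLog_of_tendsto_multiHarmonic hl
  have hi := intervalIntegrable_neg_log_one_sub_pow_div k
  have hle : 𝓝[<] (1 : ℝ) ≤ 𝓝[Set.uIcc 0 1] 1 := by
    rw [Set.uIcc_of_le zero_le_one, ← nhdsWithin_Ico_eq_nhdsLT zero_lt_one]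
    exact nhdsWithin_mono _ Set.Ico_subset_Icc_self
  -- Integrability alone makes the primitives continuous up to `1`, despite the logarithmic
  -- singularity there.
  have c1 := intervalIntegral.continuousOn_primitive_interval' hi Set.left_mem_uIcc 1
    Set.right_mem_uIcc
  have c2 := intervalIntegral.continuousOn_primitive_interval'
    (hi.continuousOn_mul continuousOn_log_one_add) Set.left_mem_uIcc 1 Set.right_mem_uIcc
  have c3 := continuousOn_log_one_add 1 Set.right_mem_uIcc
  have h2 := ((c3.mul c1).sub c2).tendsto.mono_left hle
  simp only [Pi.sub_apply, Pi.mul_apply, one_add_one_eq_two, ← multiPolyLog_succ_one_half] at h2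
  have h3 := h2.congr' (f₂ := multiPolyLog (-1 :: 1 :: -1 :: List.replicate (k - 1) 1)) (by
    filter_upwards [Ico_mem_nhdsLT (zero_lt_one : (0 : ℝ) < 1)] with x hx
    exact (multiPolyLog_neg_one_one_neg_one hk hx.1 hx.2).symm)
  rwa [tendsto_nhds_unique h1 h3] at hl

/-! ### Binomial collapse and conclusion. -/

/-- `C(k,i) C(i,l) = C(k,l) C(k-l,i-l)` reduces the sum to `(1-1)^(k-l)`. -/
theorem alternating_sum_choose_mul_choose (k l : ℕ) :
    ∑ i ∈ Finset.Ico l (k + 1), (-1 : ℝ) ^ i * (k.choose i : ℝ) * (i.choose l : ℝ) =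
      if l = k then (-1) ^ k else 0 := by
  rcases lt_or_ge k l with h | h
  · rw [Finset.Ico_eq_empty (by omega), Finset.sum_empty, if_neg (by omega)]
  obtain ⟨m, rfl⟩ := Nat.exists_eq_add_of_le h
  rw [Finset.sum_Ico_eq_sum_range, show l + m + 1 - l = m + 1 by omega]
  have e : ∀ i ∈ Finset.range (m + 1), (-1 : ℝ) ^ (l + i) * ((l + m).choose (l + i) : ℝ) *
      ((l + i).choose l : ℝ) =
      (-1) ^ l * ((l + m).choose l : ℝ) * (((-1) ^ i * (m.choose i : ℤ) : ℤ) : ℝ) := fun i _ => by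
    have h := Nat.choose_mul (n := l + m) (k := l + i) (s := l) (by omega)
    rw [Nat.add_sub_cancel_left, Nat.add_sub_cancel_left] at h
    have h' : ((l + m).choose (l + i) : ℝ) * ((l + i).choose l : ℝ) =
        ((l + m).choose l : ℝ) * (m.choose i : ℝ) := by exact_mod_cast h
    push_cast
    rw [mul_assoc, h', pow_add]
    ring
  rw [Finset.sum_congr rfl e, ← Finset.mul_sum, ← Int.cast_sum, Int.alternating_sum_range_choose]
  rcases eq_or_ne m 0 with rfl | hm
  · simp
  · simp [hm]

theorem alternating_sum_sum_choose_mul_choose (k : ℕ) (f : ℕ → ℝ) :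
    ∑ i ∈ Finset.range (k + 1), ∑ l ∈ Finset.range (i + 1),
      (-1 : ℝ) ^ i * (k.choose i : ℝ) * (i.choose l : ℝ) * f l = (-1) ^ k * f k := by
  have hcomm : ∑ i ∈ Finset.range (k + 1), ∑ l ∈ Finset.range (i + 1),
      (-1 : ℝ) ^ i * (k.choose i : ℝ) * (i.choose l : ℝ) * f l =
      ∑ l ∈ Finset.range (k + 1), ∑ i ∈ Finset.Ico l (k + 1),
        (-1 : ℝ) ^ i * (k.choose i : ℝ) * (i.choose l : ℝ) * f l :=
    Finset.sum_comm' fun i l => by simp only [Finset.mem_range, Finset.mem_Ico]; omega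
  rw [hcomm]
  simp only [← Finset.sum_mul, alternating_sum_choose_mul_choose]
  simp

theorem corollary4p2 (k : ℕ) (hk : 1 ≤ k) :
    Tendsto (multiHarmonic ([-1, 1, -1] ++ List.replicate (k - 1) 1)) atTop
      (𝓝 (multiZeta ([-1, 1, -1] ++ List.replicate (k - 1) 1))) ∧
    multiZeta ([-1, 1, -1] ++ List.replicate (k - 1) 1) =
      Real.log 2 * polyLog (k + 1) (1 / 2)
      - (-1 : ℝ) ^ k / (k.factorial : ℝ) *
        (∑ i ∈ Finset.range (k + 1), ∑ l ∈ Finset.range (i + 1),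
          (-1 : ℝ) ^ i * (l.factorial : ℝ) * (k.choose i : ℝ) * (i.choose l : ℝ) *
            Real.log 2 ^ (k + 1 - l) * polyLog (l + 1) (1 / 2))
      - (-1 : ℝ) ^ k / (k.factorial : ℝ) *
        (∑ i ∈ Finset.range (k + 1), ∑ l ∈ Finset.range (i + 1),
          (-1 : ℝ) ^ ((i : ℤ) - 1) * (l.factorial : ℝ) * (k.choose i : ℝ) * (i.choose l : ℝ) *
            Real.log 2 ^ (k - l) * multiPolyLog [(l : ℤ) + 1, 1] (1 / 2)) := by
  have hlim := tendsto_multiHarmonic_neg_one_one_neg_one hk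
  have hz : multiZeta ([-1, 1, -1] ++ List.replicate (k - 1) 1) =
      multiPolyLog [(k : ℤ) + 1, 1] (1 / 2) := hlim.limUnder_eq
  refine ⟨hz ▸ hlim, ?_⟩
  have hk0 : (k.factorial : ℝ) ≠ 0 := by positivity
  have hsq : (-1 : ℝ) ^ k * (-1 : ℝ) ^ k = 1 := by rw [← mul_pow]; norm_num
  have h1 := alternating_sum_sum_choose_mul_choose k
    (fun l => (l.factorial : ℝ) * Real.log 2 ^ (k + 1 - l) * polyLog (l + 1) (1 / 2))
  -- The minus sign in `f` accounts for `(-1)^(i-1)` in place of `(-1)^i`.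
  have h2 := alternating_sum_sum_choose_mul_choose k
    (fun l => -((l.factorial : ℝ) * Real.log 2 ^ (k - l) * multiPolyLog [(l : ℤ) + 1, 1] (1 / 2)))
  rw [hz, Finset.sum_congr rfl fun i _ => Finset.sum_congr rfl fun l _ => show
      (-1 : ℝ) ^ i * (l.factorial : ℝ) * (k.choose i : ℝ) * (i.choose l : ℝ) *
        Real.log 2 ^ (k + 1 - l) * polyLog (l + 1) (1 / 2) =
      (-1 : ℝ) ^ i * (k.choose i : ℝ) * (i.choose l : ℝ) *
        ((l.factorial : ℝ) * Real.log 2 ^ (k + 1 - l) * polyLog (l + 1) (1 / 2)) by ring, h1,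
    Finset.sum_congr rfl fun (i : ℕ) _ => Finset.sum_congr rfl fun (l : ℕ) _ => show
      (-1 : ℝ) ^ ((i : ℤ) - 1) * (l.factorial : ℝ) * (k.choose i : ℝ) * (i.choose l : ℝ) *
        Real.log 2 ^ (k - l) * multiPolyLog [(l : ℤ) + 1, 1] (1 / 2) =
      (-1 : ℝ) ^ i * (k.choose i : ℝ) * (i.choose l : ℝ) *
        -((l.factorial : ℝ) * Real.log 2 ^ (k - l) * multiPolyLog [(l : ℤ) + 1, 1] (1 / 2)) by
      rw [zpow_sub_one₀ (by norm_num), zpow_natCast]; ring, h2]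
  rw [Nat.add_sub_cancel_left, Nat.sub_self, pow_one, pow_zero]
  field_simp
  linear_combination (Real.log 2 * polyLog (k + 1) (1 / 2) -
    multiPolyLog [(k : ℤ) + 1, 1] (1 / 2)) * hsq
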